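/- Let $(a_n)_{n\ge 1}$ be a sequence of positive integers satisfying $$\limsup_{n\to\infty}\frac1n\log a_n=0.$$ Let $\sigma\colon\{0,1\}^{\mathbb Z}\to\{0,1\}^{\mathbb Z}$, $(\sigma x)_n=x_{n+1}$, be the left shift, where $\{0,1\}^{\mathbb Z}$ carries the product of the discrete topologies. For a subshift $Y$ (a closed set $Y\subseteq\{0,1\}^{\mathbb Z}$ with $\sigma(Y)=Y$) and a word $w=w_0\cdots w_{n-1}\in\{0,1\}^n$, write $[w]_0^+=\{x\in Y: x_j=w_j \text{ for } 0\le j\le n-1\}$, $\mathcal L_n(Y)=\{w\in\{0,1\}^n:[w]_0^+\ne\emptyset\}$ and $P_Y(n)=|\mathcal L_n(Y)|$. Then there exists a subshift $Y\subseteq\{0,1\}^{\mathbb Z}$ such that 1. $Y$ is minimal, that is, $Y$ is nonempty and for every $x\in Y$ the orbit $\{\sigma^g x: g\in\mathbb Z\}$ is dense in $Y$; 2. $Y$ is uniquely ergodic, that is, there is exactly one $\sigma$-invariant Borel probability measure $\mu$ on $Y$; 3. $\displaystyle\limsup_{n\to\infty}\frac{P_Y(n)}{a_n}=\infty$; 4.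 the unique invariant measure $\mu$ satisfies Boshernitzan's condition (B): there is a sequence of positive integers $n_k\to\infty$ with $$\liminf_{k\to\infty}\ \min\bigl\{\mu([w]_0^+)\cdot n_k : w\in\mathcal L_{n_k}(Y)\bigr\}>0.$$ -/

import Mathlib

open Filter MeasureTheory Topology
open scoped ENNReal

/-- Bi-infinite sequences over the alphabet `{0, 1}`, with the product of the discrete topologies and
the product σ-algebra. As `ℤ` is countable, the latter is the Borel σ-algebra. -/
abbrev BinSeq : Type := ℤ → Fin 2

/-- Subshifts of `{0, 1}^ℤ`: closed subsets that are invariant under all the shifts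
`(shift g x) h = x (g + h)`, `g : ℤ` (hence `σ(X) = X` for the left shift `σ = shift 1`). -/
abbrev BinSubshift : Type := SymbolicDynamics.FullShift.Subshift (Fin 2) ℤ

namespace BinSubshift

/-- The left shift `(σ x) n = x (n + 1)`. -/
def leftShift : BinSeq → BinSeq := SymbolicDynamics.FullShift.shift (1 : ℤ)

/-- The one-sided cylinder set of a word `w` of length `n` in `X`: the points of `X` that show `w`
at the coordinates `0, …, n - 1`. -/
def cylinder (X : BinSubshift) {n : ℕ} (w : Fin n → Fin 2) : Set BinSeq :=
  {x | x ∈ X.carrier ∧ ∀ j : Fin n, x ((j : ℕ) : ℤ) = w j}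

/-- The words of length `n` in the language of `X`. -/
def words (X : BinSubshift) (n : ℕ) : Set (Fin n → Fin 2) :=
  {w | (X.cylinder w).Nonempty}

/-- The word complexity: the number of words of length `n` (a finite set). -/
noncomputable def complexity (X : BinSubshift) (n : ℕ) : ℕ :=
  (X.words n).ncard

/-- `X` is minimal: it is nonempty and the orbit of each of its points is dense in it. -/
def IsMinimal (X : BinSubshift) : Prop :=
  X.carrier.Nonempty ∧
    ∀ x ∈ X.carrier,
      closure (Set.range fun g : ℤ => SymbolicDynamics.FullShift.shift g x) = X.carrier

/-- `μ` is a shift-invariant Borel probability measure on `X`, regarded as a measure on `{0, 1}^ℤ`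
that is carried by `X`. -/
structure IsInvariantProbability (X : BinSubshift) (μ : Measure BinSeq) : Prop where
  isProbabilityMeasure : IsProbabilityMeasure μ
  measure_compl_eq_zero : μ X.carrierᶜ = 0
  measurePreserving : MeasurePreserving leftShift μ μ

/-- `X` is uniquely ergodic: it carries exactly one shift-invariant Borel probability measure. -/
def IsUniquelyErgodic (X : BinSubshift) : Prop :=
  ∃! μ : Measure BinSeq, X.IsInvariantProbability μ

/-- The condition (B) for `X` and `μ`: along some sequence of lengths `n k → ∞`, the minimum of
`μ [w] * n k` over the words `w` of length `n k` has a positive lower limit. -/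
def ConditionB (X : BinSubshift) (μ : Measure BinSeq) : Prop :=
  ∃ n : ℕ → ℕ, Tendsto n atTop atTop ∧
    0 < liminf (fun k : ℕ => ⨅ w ∈ X.words (n k), μ (X.cylinder w) * (n k : ℝ≥0∞)) atTop

end BinSubshift

/-!
The subshift is the orbit closure of a generalized Morse sequence. A block of rank `k + 1` is
obtained from a binary word `p k` by putting the block of rank `k` for the letter `0` and its mirror
image (`0` and `1` exchanged) for the letter `1`; the points of the subshift are the sequences that
are, for every `k`, concatenations of blocks of rank `k` and their mirror images. The word `p k` is
the concatenation of all binary words of some length `N k ≥ 2` (`digitWord`). It contains both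
letters equally often, and each of the four pairs of letters at no less than an eighth of all places
(`isBalancedWord_digitWord`). These two properties carry everything except the complexity.

* Minimality: a window no longer than the blocks of rank `k` is covered by two neighbouring blocks
  of rank `k`, and every pair of such blocks occurs in every block of rank `k + 1`
  (`exists_window`, `isMinimal_morseSubshift`).
* Condition (B), along the lengths of the blocks: for the same reason, a word of the length `l` of
  the blocks of rank `k` occurs in every long window with frequency at least `1 / (16 * l)`
  (`le_birkhoff_indicator_cylinder`, `one_div_le_measure_cylinder_mul`).
* Unique ergodicity: the blocks of rank `k + 1` of both types contain equally many blocks of rank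
  `k` of each type, so that the average of a function of finitely many coordinates over such a block
  does not depend on its type, up to an error of the order of the inverse length of the blocks of
  rank `k`. Hence its integrals with respect to two invariant measures agree
  (`IsWindowFunction.exists_abs_birkhoff_sub_le`, `IsWindowFunction.integral_eq`). An invariant
  measure exists by the Krylov–Bogoliubov theorem.
* Complexity: if the blocks of rank `k` have length `l`, then the `2 ^ N k` concatenations of `N k`
  such blocks and mirror images are distinct words of length `N k * l`, and all of them occur in the
  subshift (`two_pow_le_complexity`). As `l` depends only on `N j` for `j < k`, and `a` grows
  subexponentially, `N k` can be chosen so large that `2 ^ N k > k * a (N k * l)`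
  (`exists_wordLength`).
-/

/-! ### Substitution words -/

/-- The combinatorial requirements on a binary word `p 0 ⋯ p (L - 1)`: both letters occur equally
often (tested against an arbitrary weight `g`), and each of the four pairs of letters occurs at at
least `L / 8` places. -/
structure IsBalancedWord (L : ℕ) (p : ℕ → Fin 2) : Prop where
  pos : 0 < L
  two_mul_sum : ∀ g : Fin 2 → ℝ, 2 * ∑ j ∈ Finset.range L, g (p j) = L * (g 0 + g 1)
  le_card_pairs : ∀ a b : Fin 2,
    L ≤ 8 * ((Finset.range (L - 1)).filter fun j => p j = a ∧ p (j + 1) = b).card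

/-- The concatenation of all binary words of length `N`: the letter at the place `j * N + t`, where
`t < N`, is the `t`-th binary digit of `j`. -/
def digitWord (N i : ℕ) : Fin 2 := Fin.ofNat 2 (i / N / 2 ^ (i % N))

theorem digitWord_eq {N : ℕ} (w : Fin N → Fin 2) (t : Fin N) :
    digitWord N (t + N * (finFunctionFinEquiv w : ℕ)) = w t := by
  have hN : 0 < N := t.pos
  have h1 : (t + N * (finFunctionFinEquiv w : ℕ)) / N = (finFunctionFinEquiv w : ℕ) := by
    rw [Nat.add_mul_div_left _ _ hN, Nat.div_eq_of_lt t.2, zero_add]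
  have h2 : (t + N * (finFunctionFinEquiv w : ℕ)) % N = t := by
    rw [Nat.add_mul_mod_self_left, Nat.mod_eq_of_lt t.2]
  have h3 := finFunctionFinEquiv_symm_apply_val (finFunctionFinEquiv w) t
  rw [Equiv.symm_apply_apply] at h3
  apply Fin.ext
  rw [h3, digitWord, h1, h2]
  rfl

theorem exists_digitWord_eq {N : ℕ} (w : Fin N → Fin 2) :
    ∃ q, q + N ≤ 2 ^ N * N ∧ ∀ t : Fin N, digitWord N (q + t) = w t := by
  refine ⟨N * (finFunctionFinEquiv w : ℕ), ?_, fun t => ?_⟩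
  · have : ((finFunctionFinEquiv w : ℕ) + 1) * N ≤ 2 ^ N * N :=
      Nat.mul_le_mul_right _ (finFunctionFinEquiv w).2
    linarith
  · rw [add_comm, digitWord_eq]

theorem two_mul_sum_apply {N : ℕ} (g : Fin 2 → ℝ) (t : Fin N) :
    2 * ∑ w : Fin N → Fin 2, g (w t) = 2 ^ N * (g 0 + g 1) := by
  have h : ∑ w : Fin N → Fin 2, g (w t) = ∑ w : Fin N → Fin 2, g (w t + 1) :=
    (Equiv.sum_comp (Equiv.addRight (fun _ : Fin N => (1 : Fin 2))) fun w => g (w t)).symm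
  have h2 : ∀ a : Fin 2, g a + g (a + 1) = g 0 + g 1 := by
    intro a
    fin_cases a
    · rfl
    · exact add_comm _ _
  calc 2 * ∑ w : Fin N → Fin 2, g (w t)
      = ∑ w : Fin N → Fin 2, g (w t) + ∑ w : Fin N → Fin 2, g (w t + 1) := by
        rw [← h, two_mul]
    _ = ∑ w : Fin N → Fin 2, (g 0 + g 1) := by
        rw [← Finset.sum_add_distrib]
        exact Finset.sum_congr rfl fun w _ => h2 _
    _ = 2 ^ N * (g 0 + g 1) := by simp [mul_add]

theorem card_words_pair {N : ℕ} {t s : Fin N} (hts : t ≠ s) (a b : Fin 2) :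
    4 * (Finset.univ.filter fun w : Fin N → Fin 2 => w t = a ∧ w s = b).card = 2 ^ N := by
  -- Translations permute the four classes of words, which therefore have the same size.
  have key : ∀ c d : Fin 2,
      (Finset.univ.filter fun w : Fin N → Fin 2 => w t = c ∧ w s = d).card =
        (Finset.univ.filter fun w : Fin N → Fin 2 => w t = a ∧ w s = b).card := by
    intro c d
    refine Finset.card_equiv
      (Equiv.addRight (Pi.single t (a - c) + Pi.single s (b - d) : Fin N → Fin 2)) fun w => ?_
    simp only [Finset.mem_filter, Finset.mem_univ, true_and, Equiv.coe_addRight, Pi.add_apply,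
      Pi.single_eq_same, Pi.single_eq_of_ne hts, Pi.single_eq_of_ne hts.symm, add_zero, zero_add]
    have h : ∀ u v z : Fin 2, u = v ↔ u + (z - v) = z := by decide
    exact and_congr (h _ _ _) (h _ _ _)
  have hsum := Finset.card_eq_sum_card_fiberwise (s := (Finset.univ : Finset (Fin N → Fin 2)))
    (t := (Finset.univ : Finset (Fin 2 × Fin 2))) (f := fun w => (w t, w s))
    fun _ _ => Finset.mem_coe.2 (Finset.mem_univ _)
  simp only [Prod.ext_iff] at hsum
  rw [Finset.sum_congr rfl fun c _ => key c.1 c.2] at hsum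
  simpa using hsum.symm

theorem isBalancedWord_digitWord {N : ℕ} (hN : 2 ≤ N) :
    IsBalancedWord (2 ^ N * N) (digitWord N) where
  pos := by positivity
  two_mul_sum g := by
    have h1 : ∑ j ∈ Finset.range (2 ^ N * N), g (digitWord N j) =
        ∑ t : Fin N, ∑ w : Fin N → Fin 2, g (w t) := by
      rw [Finset.sum_range, ← Equiv.sum_comp finProdFinEquiv, Fintype.sum_prod_type_right]
      refine Finset.sum_congr rfl fun t _ => ?_
      rw [← Equiv.sum_comp finFunctionFinEquiv]
      refine Finset.sum_congr rfl fun w _ => ?_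
      rw [finProdFinEquiv_apply_val, digitWord_eq]
    rw [h1, Finset.mul_sum, Finset.sum_congr rfl fun t _ => two_mul_sum_apply g t]
    simp
    ring
  le_card_pairs a b := by
    -- Only the pairs inside one of the concatenated words are counted.
    let f : (Σ _ : Fin (N - 1), Fin N → Fin 2) → ℕ :=
      fun z => (z.1 : ℕ) + N * (finFunctionFinEquiv z.2 : ℕ)
    let S : Finset (Σ _ : Fin (N - 1), Fin N → Fin 2) :=
      Finset.univ.sigma fun t => Finset.univ.filter fun w : Fin N → Fin 2 =>
        w ⟨t, by omega⟩ = a ∧ w ⟨t + 1, by omega⟩ = b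
    have hcard : 4 * S.card = (N - 1) * 2 ^ N := by
      have h (t : Fin (N - 1)) := card_words_pair (N := N) (t := ⟨t, by omega⟩)
        (s := ⟨t + 1, by omega⟩) (by simp) a b
      simp [S, Finset.card_sigma, Finset.mul_sum, h]
    have hle : S.card ≤ ((Finset.range (2 ^ N * N - 1)).filter
        fun j => digitWord N j = a ∧ digitWord N (j + 1) = b).card := by
      refine Finset.card_le_card_of_injOn f ?_ ?_
      · rintro ⟨t, w⟩ hz
        simp only [S, Finset.coe_sigma, Set.mem_sigma_iff, Finset.mem_coe, Finset.mem_univ,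
          Finset.mem_filter, true_and] at hz
        have h1 := digitWord_eq w ⟨t, by omega⟩
        have h2 := digitWord_eq w ⟨t + 1, by omega⟩
        have h3 : ((finFunctionFinEquiv w : ℕ) + 1) * N ≤ 2 ^ N * N :=
          Nat.mul_le_mul_right _ (finFunctionFinEquiv w).2
        simp only [f, Finset.coe_filter, Finset.mem_range, Set.mem_ofPred_eq]
        refine ⟨?_, h1.trans hz.1, ?_⟩
        · have := t.2
          have h4 : ((finFunctionFinEquiv w : ℕ) + 1) * N =
            N * (finFunctionFinEquiv w : ℕ) + N := by ring
          omega
        · rw [← hz.2, ← h2]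
          congr 1
          simp only
          ring
      · rintro ⟨t, w⟩ - ⟨t', w'⟩ - h
        simp only [f] at h
        have ht : (t : ℕ) < N := by omega
        have ht' : (t' : ℕ) < N := by omega
        have e1 : (t : ℕ) = t' := by
          have := congrArg (· % N) h
          simpa [Nat.add_mul_mod_self_left, Nat.mod_eq_of_lt ht, Nat.mod_eq_of_lt ht'] using this
        have e2 : w = w' := by
          apply finFunctionFinEquiv.injective
          apply Fin.ext
          have : N * (finFunctionFinEquiv w : ℕ) = N * (finFunctionFinEquiv w' : ℕ) := by omega
          exact Nat.eq_of_mul_eq_mul_left (by omega) this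
        obtain rfl := Fin.ext e1
        rw [e2]
    obtain ⟨n, rfl⟩ : ∃ n, N = n + 2 := ⟨N - 2, by omega⟩
    have : (n + 2 - 1) * 2 ^ (n + 2) = (n + 1) * 2 ^ (n + 2) := rfl
    nlinarith [Nat.zero_le (n * 2 ^ (n + 2))]

/-! ### Generalized Morse sequences -/

/-- The lengths `L 0 * ⋯ * L (k - 1)` of the blocks of rank `k`. -/
def blockLength (L : ℕ → ℕ) : ℕ → ℕ
  | 0 => 1
  | k + 1 => blockLength L k * L k

/-- The block of rank `k` built from the words `p 0, p 1, …` of lengths `L 0, L 1, …`: the block of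
rank `k + 1` arises from `p k` by putting the block of rank `k` for the letter `0`, and its mirror
image (where `0` and `1` are exchanged) for the letter `1`. Only the letters at the places below
`blockLength L k` matter. Addition in `Fin 2` is addition modulo `2`, so that the block and its
mirror image are `i ↦ block L p k i + a` for the two letters `a`. -/
def block (L : ℕ → ℕ) (p : ℕ → ℕ → Fin 2) : ℕ → ℕ → Fin 2
  | 0, _ => 0
  | k + 1, i => block L p k (i % blockLength L k) + p k (i / blockLength L k)

/-- The block of rank `k`, shifted by the letter `a`, stands in `x` at the place `s`. -/
def HasBlock (L : ℕ → ℕ) (p : ℕ → ℕ → Fin 2) (k : ℕ) (a : Fin 2) (x : BinSeq) (s : ℤ) : Prop :=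
  ∀ i : ℕ, i < blockLength L k → x (s + i) = block L p k i + a

/-- The sequence `x` is a concatenation of blocks of rank `k` and their mirror images, one of which
begins at the place `r`. -/
def IsAligned (L : ℕ → ℕ) (p : ℕ → ℕ → Fin 2) (k : ℕ) (x : BinSeq) (r : ℤ) : Prop :=
  ∀ j : ℤ, ∃ a : Fin 2, HasBlock L p k a x (r + j * blockLength L k)

variable {L : ℕ → ℕ} {p : ℕ → ℕ → Fin 2}

theorem blockLength_pos (hL : ∀ k, 0 < L k) (k : ℕ) : 0 < blockLength L k := by
  induction k with
  | zero => exact Nat.one_pos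
  | succ k ih => exact Nat.mul_pos ih (hL k)

theorem two_pow_le_blockLength (hL : ∀ k, 2 ≤ L k) (k : ℕ) : 2 ^ k ≤ blockLength L k := by
  induction k with
  | zero => exact le_rfl
  | succ k ih => exact Nat.mul_le_mul ih (hL k)

theorem block_succ_mul_add {k i : ℕ} (hi : i < blockLength L k) (j : ℕ) :
    block L p (k + 1) (j * blockLength L k + i) = block L p k i + p k j := by
  have hpos : 0 < blockLength L k := by omega
  have h1 : (j * blockLength L k + i) % blockLength L k = i := by
    rw [mul_comm, Nat.mul_add_mod, Nat.mod_eq_of_lt hi]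
  have h2 : (j * blockLength L k + i) / blockLength L k = j := by
    rw [mul_comm, Nat.mul_add_div hpos, Nat.div_eq_of_lt hi, add_zero]
  rw [block, h1, h2]

theorem HasBlock.sub_block {k : ℕ} {a : Fin 2} {x : BinSeq} {s : ℤ}
    (h : HasBlock L p (k + 1) a x s) {j : ℕ} (hj : j < L k) :
    HasBlock L p k (p k j + a) x (s + j * blockLength L k) := by
  intro i hi
  have h1 : j * blockLength L k + i < blockLength L (k + 1) := by
    have : (j + 1) * blockLength L k ≤ L k * blockLength L k := Nat.mul_le_mul_right _ hj
    rw [blockLength]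
    linarith
  have h2 := h _ h1
  rw [block_succ_mul_add hi, add_assoc] at h2
  rw [← h2]
  congr 1
  push_cast
  ring

theorem hasBlock_shift {k : ℕ} {a : Fin 2} {x : BinSeq} {s g : ℤ} :
    HasBlock L p k a (SymbolicDynamics.FullShift.shift g x) s ↔ HasBlock L p k a x (g + s) := by
  simp only [HasBlock, SymbolicDynamics.FullShift.shift_apply, add_assoc]

theorem IsAligned.add_mul {k : ℕ} {x : BinSeq} {r : ℤ} (h : IsAligned L p k x r) (q : ℤ) :
    IsAligned L p k x (r + q * blockLength L k) := by
  intro j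
  obtain ⟨a, ha⟩ := h (q + j)
  exact ⟨a, by rwa [add_assoc, ← _root_.add_mul]⟩

theorem IsAligned.exists_hasBlock {k : ℕ} {x : BinSeq} {r : ℤ} (h : IsAligned L p k x r) :
    ∃ a, HasBlock L p k a x r := by
  simpa using h 0

/-- A block of rank `k` begins in each interval whose length is that of these blocks. -/
theorem IsAligned.exists_mem_Ico (hL : ∀ k, 0 < L k) {k : ℕ} {x : BinSeq} {r : ℤ}
    (h : IsAligned L p k x r) (n : ℤ) :
    ∃ r', n ≤ r' ∧ r' < n + blockLength L k ∧ IsAligned L p k x r' := by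
  have hpos : (0 : ℤ) < blockLength L k := by exact_mod_cast blockLength_pos hL k
  refine ⟨r + (-((r - n) / blockLength L k)) * blockLength L k, ?_, ?_, h.add_mul _⟩
  · have := Int.emod_nonneg (r - n) hpos.ne'
    have := Int.emod_add_mul_ediv (r - n) (blockLength L k)
    linarith
  · have := Int.emod_lt_of_pos (r - n) hpos
    have := Int.emod_add_mul_ediv (r - n) (blockLength L k)
    linarith

theorem IsAligned.of_succ (hL : ∀ k, 0 < L k) {k : ℕ} {x : BinSeq} {r : ℤ}
    (h : IsAligned L p (k + 1) x r) : IsAligned L p k x r := by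
  intro j
  have hpos : (0 : ℤ) < L k := by exact_mod_cast hL k
  obtain ⟨a, ha⟩ := h (j / L k)
  have h0 := Int.emod_nonneg j hpos.ne'
  have h1 := Int.emod_lt_of_pos j hpos
  have h2 := Int.emod_add_mul_ediv j (L k)
  refine ⟨p k (j % L k).toNat + a, ?_⟩
  have h3 := ha.sub_block (j := (j % L k).toNat) (by omega)
  have h4 : ((j % L k).toNat : ℤ) = j % L k := Int.toNat_of_nonneg h0
  rw [h4] at h3
  convert h3 using 1
  nth_rewrite 1 [← h2]
  rw [blockLength]
  push_cast
  ring

theorem isClosed_setOf_hasBlock (k : ℕ) (a : Fin 2) (s : ℤ) :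
    IsClosed {x : BinSeq | HasBlock L p k a x s} := by
  simp only [HasBlock, Set.ofPred_forall]
  exact isClosed_iInter fun i => isClosed_iInter fun _ =>
    isClosed_eq (continuous_apply _) continuous_const

theorem isClosed_setOf_exists_isAligned (hL : ∀ k, 0 < L k) (k : ℕ) :
    IsClosed {x : BinSeq | ∃ r, IsAligned L p k x r} := by
  have heq : {x : BinSeq | ∃ r, IsAligned L p k x r} =
      ⋃ r ∈ Finset.Ico (0 : ℤ) (blockLength L k), {x | IsAligned L p k x r} := by
    ext x
    simp only [Set.mem_iUnion, Finset.mem_Ico]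
    constructor
    · rintro ⟨r, hr⟩
      obtain ⟨r', h1, h2, h3⟩ := hr.exists_mem_Ico hL 0
      exact ⟨r', ⟨h1, by simpa using h2⟩, h3⟩
    · rintro ⟨r, -, hr⟩
      exact ⟨r, hr⟩
  rw [heq]
  refine isClosed_biUnion_finset fun r _ => ?_
  have heq2 : {x : BinSeq | IsAligned L p k x r} =
      ⋂ j : ℤ, ⋃ a : Fin 2, {x | HasBlock L p k a x (r + j * blockLength L k)} := by
    ext x
    simp only [Set.mem_iInter, Set.mem_iUnion]
    rfl
  rw [heq2]
  exact isClosed_iInter fun j => isClosed_iUnion_of_finite fun a => isClosed_setOf_hasBlock _ _ _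

theorem nonempty_setOf_exists_isAligned (k : ℕ) :
    {x : BinSeq | ∃ r, IsAligned L p k x r}.Nonempty := by
  refine ⟨fun n => block L p k (n % blockLength L k).toNat, 0, fun j => ⟨0, fun i hi => ?_⟩⟩
  have : (0 + j * (blockLength L k : ℤ) + i) % blockLength L k = i := by
    rw [zero_add, add_comm, Int.add_mul_emod_self_right]
    exact Int.emod_eq_of_lt (by positivity) (by exact_mod_cast hi)
  simp only [this, Int.toNat_natCast, add_zero]

/-- The subshift of the generalized Morse sequence of the words `p k`: its points are the sequences
that, for each `k`, are concatenations of blocks of rank `k` and their mirror images. -/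
def morseSubshift (L : ℕ → ℕ) (p : ℕ → ℕ → Fin 2) (hL : ∀ k, 0 < L k) : BinSubshift where
  carrier := ⋂ k, {x | ∃ r, IsAligned L p k x r}
  isClosed := isClosed_iInter fun k => isClosed_setOf_exists_isAligned hL k
  mapsTo g x hx := by
    refine Set.mem_iInter.2 fun k => ?_
    obtain ⟨r, hr⟩ := Set.mem_iInter.1 hx k
    refine ⟨r - g, fun j => ?_⟩
    obtain ⟨a, ha⟩ := hr j
    refine ⟨a, hasBlock_shift.2 ?_⟩
    convert ha using 1
    ring

theorem exists_isAligned {hL : ∀ k, 0 < L k} {x : BinSeq}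
    (hx : x ∈ (morseSubshift L p hL).carrier) (k : ℕ) (n : ℤ) :
    ∃ r, n ≤ r ∧ r < n + blockLength L k ∧ IsAligned L p k x r := by
  obtain ⟨r, hr⟩ := Set.mem_iInter.1 hx k
  exact hr.exists_mem_Ico hL n

theorem morseSubshift_nonempty (hL : ∀ k, 0 < L k) : (morseSubshift L p hL).carrier.Nonempty :=
  IsCompact.nonempty_iInter_of_sequence_nonempty_isCompact_isClosed _
    (fun _ _ ⟨r, hr⟩ => ⟨r, hr.of_succ hL⟩) nonempty_setOf_exists_isAligned
    (isClosed_setOf_exists_isAligned hL 0).isCompact (isClosed_setOf_exists_isAligned hL)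

/-! ### Minimality and complexity -/

theorem IsBalancedWord.exists_pair {n : ℕ} {q : ℕ → Fin 2} (h : IsBalancedWord n q) (a b : Fin 2) :
    ∃ j, j + 1 < n ∧ q j = a ∧ q (j + 1) = b := by
  have h1 := h.le_card_pairs a b
  have h2 := h.pos
  have h3 : 0 < ((Finset.range (n - 1)).filter fun j => q j = a ∧ q (j + 1) = b).card := by omega
  obtain ⟨j, hj⟩ := Finset.card_pos.1 h3
  rw [Finset.mem_filter, Finset.mem_range] at hj
  exact ⟨j, by omega, hj.2⟩

theorem IsBalancedWord.two_le {n : ℕ} {q : ℕ → Fin 2} (h : IsBalancedWord n q) : 2 ≤ n := by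
  obtain ⟨j, hj, -⟩ := h.exists_pair 0 0
  omega

/-- The two blocks of rank `k` that stand at the places `j` and `j + 1` of a block of rank `k + 1`
of type `c`. -/
theorem HasBlock.sub_block_pair {k : ℕ} {a b c : Fin 2} {x : BinSeq} {r : ℤ}
    (h : HasBlock L p (k + 1) c x r) {j : ℕ} (hj : j + 1 < L k) (ha : p k j = a - c)
    (hb : p k (j + 1) = b - c) :
    HasBlock L p k a x (r + j * blockLength L k) ∧
      HasBlock L p k b x (r + j * blockLength L k + blockLength L k) := by
  have h1 := h.sub_block (j := j) (by omega)
  have h2 := h.sub_block hj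
  rw [ha, sub_add_cancel] at h1
  rw [hb, sub_add_cancel] at h2
  refine ⟨h1, ?_⟩
  convert h2 using 1
  push_cast
  ring

/-- A window of the length of the blocks of rank `k` is covered by two consecutive blocks of rank
`k`, so that it recurs wherever the same two blocks are next to each other. -/
theorem exists_window {hL : ∀ k, 0 < L k} {y : BinSeq} (hy : y ∈ (morseSubshift L p hL).carrier)
    (k : ℕ) (n : ℤ) :
    ∃ (a b : Fin 2) (t : ℕ), t < blockLength L k ∧ ∀ (x : BinSeq) (s : ℤ),
      HasBlock L p k a x s → HasBlock L p k b x (s + blockLength L k) →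
        ∀ i : ℕ, i < blockLength L k → x (s + t + i) = y (n + i) := by
  obtain ⟨r, hr1, hr2, hr⟩ := exists_isAligned hy k (n - blockLength L k + 1)
  obtain ⟨a, ha⟩ := hr.exists_hasBlock
  obtain ⟨b, hb⟩ := (hr.add_mul 1).exists_hasBlock
  rw [one_mul] at hb
  have ht : ((n - r).toNat : ℤ) = n - r := Int.toNat_of_nonneg (by omega)
  refine ⟨a, b, (n - r).toNat, by omega, fun x s hxa hxb i hi => ?_⟩
  rcases lt_or_ge ((n - r).toNat + i) (blockLength L k) with hlt | hge
  · have h1 := hxa _ hlt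
    rw [← ha _ hlt] at h1
    convert h1 using 2 <;> push_cast <;> omega
  · obtain ⟨d, hd⟩ := Nat.exists_eq_add_of_le hge
    have hlt : d < blockLength L k := by omega
    have h1 := hxb _ hlt
    rw [← hb _ hlt] at h1
    convert h1 using 2 <;> omega

theorem shift_mem_morseSubshift {hL : ∀ k, 0 < L k} {x : BinSeq}
    (hx : x ∈ (morseSubshift L p hL).carrier) (g : ℤ) :
    SymbolicDynamics.FullShift.shift g x ∈ (morseSubshift L p hL).carrier :=
  (morseSubshift L p hL).mapsTo g hx

theorem isMinimal_morseSubshift {hL : ∀ k, 0 < L k} (hp : ∀ k, IsBalancedWord (L k) (p k)) :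
    (morseSubshift L p hL).IsMinimal := by
  refine ⟨morseSubshift_nonempty hL, fun x hx => Set.Subset.antisymm ?_ fun y hy => ?_⟩
  · refine closure_minimal ?_ (morseSubshift L p hL).isClosed
    rintro _ ⟨g, rfl⟩
    exact shift_mem_morseSubshift hx g
  · rw [mem_closure_iff]
    intro o ho hyo
    obtain ⟨I, u, hu, hsub⟩ := isOpen_pi_iff.1 ho y hyo
    obtain ⟨m, hm⟩ : ∃ m : ℕ, ∀ i ∈ I, i.natAbs ≤ m :=
      ⟨I.sup Int.natAbs, fun i hi => Finset.le_sup (f := Int.natAbs) hi⟩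
    have hk : 2 * m + 1 < blockLength L (2 * m + 1) :=
      (Nat.lt_two_pow_self).trans_le (two_pow_le_blockLength (fun k => (hp k).two_le) _)
    set k := 2 * m + 1
    obtain ⟨a, b, t, -, hwin⟩ := exists_window hy k (-m)
    obtain ⟨r, -, -, hr⟩ := exists_isAligned hx (k + 1) 0
    obtain ⟨c, hc⟩ := hr.exists_hasBlock
    obtain ⟨j, hj, hja, hjb⟩ := (hp k).exists_pair (a - c) (b - c)
    obtain ⟨h1, h2⟩ := hc.sub_block_pair hj hja hjb
    refine ⟨_, hsub fun i hi => ?_, r + j * blockLength L k + t + m, rfl⟩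
    have hi' := hm i hi
    have h3 := hwin x _ h1 h2 (i + m).toNat (by omega)
    have h4 : ((i + m).toNat : ℤ) = i + m := Int.toNat_of_nonneg (by omega)
    rw [h4] at h3
    have h5 : SymbolicDynamics.FullShift.shift (r + j * blockLength L k + t + m) x i = y i := by
      rw [SymbolicDynamics.FullShift.shift_apply]
      convert h3 using 2 <;> ring
    exact Set.mem_of_eq_of_mem h5 (hu i hi).2

/-- If `p k` contains all words of length `N`, then all concatenations of `N` blocks of rank `k` and
mirror images of them occur in the subshift. -/
theorem two_pow_le_complexity {hL : ∀ k, 0 < L k} {k N : ℕ}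
    (hfull : ∀ w : Fin N → Fin 2, ∃ q, q + N ≤ L k ∧ ∀ t : Fin N, p k (q + t) = w t) :
    2 ^ N ≤ (morseSubshift L p hL).complexity (N * blockLength L k) := by
  have hpos := blockLength_pos hL k
  let F : (Fin N → Fin 2) → Fin (N * blockLength L k) → Fin 2 := fun w i =>
    block L p k (i % blockLength L k) +
      w ⟨i / blockLength L k, (Nat.div_lt_iff_lt_mul hpos).2 i.2⟩
  have hF : Function.Injective F := by
    intro w w' h
    funext t
    have h1 : (t : ℕ) * blockLength L k < N * blockLength L k :=
      Nat.mul_lt_mul_of_pos_right t.2 hpos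
    have h2 := congrFun h ⟨t * blockLength L k, h1⟩
    simpa [F, Nat.mul_div_cancel _ hpos] using h2
  have hmem : Set.range F ⊆ (morseSubshift L p hL).words (N * blockLength L k) := by
    rintro _ ⟨w, rfl⟩
    obtain ⟨x, hx⟩ := morseSubshift_nonempty (p := p) hL
    obtain ⟨r, -, -, hr⟩ := exists_isAligned hx (k + 1) 0
    obtain ⟨c, hc⟩ := hr.exists_hasBlock
    obtain ⟨q, hq, hqw⟩ := hfull fun t => w t - c
    refine ⟨_, shift_mem_morseSubshift hx (r + q * blockLength L k), fun i => ?_⟩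
    have hi : (i : ℕ) / blockLength L k < N :=
      (Nat.div_lt_iff_lt_mul hpos).2 i.2
    have h1 := hc.sub_block (j := q + i / blockLength L k) (by omega) _ (Nat.mod_lt i hpos)
    rw [hqw ⟨_, hi⟩, sub_add_cancel] at h1
    refine Eq.trans ?_ h1
    rw [SymbolicDynamics.FullShift.shift_apply]
    congr 1
    have h2 : ((blockLength L k * (i / blockLength L k) + i % blockLength L k : ℕ) : ℤ) = i := by
      rw [Nat.div_add_mod]
    push_cast at h2 ⊢
    linear_combination -h2
  calc 2 ^ N = (Set.range F).ncard := by
        rw [← Set.image_univ, Set.ncard_image_of_injective _ hF, Set.ncard_univ]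
        simp
    _ ≤ _ := Set.ncard_le_ncard hmem (Set.toFinite _)

/-! ### Birkhoff sums over blocks -/

theorem sum_range_mul_eq (u : ℕ → ℝ) (n m : ℕ) :
    ∑ i ∈ Finset.range (n * m), u i =
      ∑ j ∈ Finset.range n, ∑ i ∈ Finset.range m, u (j * m + i) := by
  induction n with
  | zero => simp
  | succ n ih => rw [Nat.succ_mul, Finset.sum_range_add, ih, Finset.sum_range_succ]

/-- Moving the window of summation by `r` places changes a sum of numbers in `[0, 1]` by at most
`r`. -/
theorem abs_sum_sub_sum_add_le {u : ℤ → ℝ} (h0 : ∀ i, 0 ≤ u i) (h1 : ∀ i, u i ≤ 1) (n r : ℕ) :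
    |∑ i ∈ Finset.range n, u i - ∑ i ∈ Finset.range n, u (r + i)| ≤ r := by
  induction r with
  | zero => simp
  | succ r ih =>
    have hstep : ∑ i ∈ Finset.range n, u ((r + 1 : ℕ) + i) =
        ∑ i ∈ Finset.range n, u (r + i) + u (r + n) - u r := by
      have e1 := Finset.sum_range_succ (fun i : ℕ => u (r + i)) n
      have e2 := Finset.sum_range_succ' (fun i : ℕ => u (r + i)) n
      have e3 : ∀ i : ℕ, u ((r + 1 : ℕ) + i) = u (r + (i + 1 : ℕ)) := fun i => by
        congr 1
        push_cast
        ring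
      simp only [e3]
      simp only [Nat.cast_zero, add_zero] at e2
      linarith
    rw [hstep, abs_le]
    have := h0 (r + n)
    have := h1 (r + n)
    have := h0 r
    have := h1 r
    rw [abs_le] at ih
    push_cast
    constructor <;> linarith [ih.1, ih.2]

/-- `f` takes values in `[0, 1]` and depends only on the coordinates of absolute value at most
`m`. -/
structure IsWindowFunction (m : ℕ) (f : BinSeq → ℝ) : Prop where
  nonneg : ∀ x, 0 ≤ f x
  le_one : ∀ x, f x ≤ 1
  eq_of_eq : ∀ x y : BinSeq, (∀ i : ℤ, i.natAbs ≤ m → x i = y i) → f x = f y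

open SymbolicDynamics.FullShift (shift shift_apply)

/-- The sum of `f` over a block depends on the surroundings of the block only through the at most
`2 * m` places near its ends. -/
theorem IsWindowFunction.abs_sum_block_sub_le {m : ℕ} {f : BinSeq → ℝ} (hf : IsWindowFunction m f)
    {k : ℕ} {a : Fin 2} {x y : BinSeq} {s r : ℤ} (hx : HasBlock L p k a x s)
    (hy : HasBlock L p k a y r) :
    |∑ i ∈ Finset.range (blockLength L k), f (shift (s + i) x) -
      ∑ i ∈ Finset.range (blockLength L k), f (shift (r + i) y)| ≤ 2 * m := by
  set ℓ := blockLength L k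
  rw [← Finset.sum_sub_distrib]
  have hterm : ∀ i ∈ Finset.range ℓ, |f (shift (s + i) x) - f (shift (r + i) y)| ≤
      if i < m ∨ ℓ ≤ i + m then 1 else 0 := by
    intro i hi
    split_ifs with h
    · rw [abs_le]
      have := hf.nonneg (shift (s + i) x)
      have := hf.le_one (shift (s + i) x)
      have := hf.nonneg (shift (r + i) y)
      have := hf.le_one (shift (r + i) y)
      constructor <;> linarith
    · rw [not_or, not_lt, not_le] at h
      rw [hf.eq_of_eq (shift (s + i) x) (shift (r + i) y), sub_self, abs_zero]
      intro d hd
      have hn : ((i + d).toNat : ℤ) = i + d := Int.toNat_of_nonneg (by omega)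
      have hlt : (i + d).toNat < ℓ := by omega
      have e1 := hx _ hlt
      rw [← hy _ hlt, hn] at e1
      rwa [shift_apply, shift_apply, add_assoc, add_assoc]
  calc |∑ i ∈ Finset.range ℓ, (f (shift (s + i) x) - f (shift (r + i) y))|
      ≤ ∑ i ∈ Finset.range ℓ, |f (shift (s + i) x) - f (shift (r + i) y)| :=
        Finset.abs_sum_le_sum_abs _ _
    _ ≤ ∑ i ∈ Finset.range ℓ, if i < m ∨ ℓ ≤ i + m then (1 : ℝ) else 0 :=
        Finset.sum_le_sum hterm
    _ = ((Finset.range ℓ).filter fun i => i < m ∨ ℓ ≤ i + m).card := by rw [Finset.sum_boole]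
    _ ≤ ((Finset.range m ∪ Finset.Ico (ℓ - m) ℓ).card : ℕ) := by
        refine Nat.cast_le.2 (Finset.card_le_card fun i hi => ?_)
        simp only [Finset.mem_filter, Finset.mem_range, Finset.mem_union, Finset.mem_Ico] at hi ⊢
        omega
    _ ≤ 2 * m := by
        have h := Finset.card_union_le (Finset.range m) (Finset.Ico (ℓ - m) ℓ)
        rw [Finset.card_range, Nat.card_Ico] at h
        have : (Finset.range m ∪ Finset.Ico (ℓ - m) ℓ).card ≤ 2 * m := by omega
        exact_mod_cast this

/-- A block of rank `k + 1`, of either type, contains as many blocks of rank `k` of one type as of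
the other. Hence the sums of `f` over them are close to a number `K` that depends neither on the type
nor on the surroundings. -/
theorem IsWindowFunction.exists_abs_sum_succ_block_sub_le (hp : ∀ k, IsBalancedWord (L k) (p k))
    {m : ℕ} {f : BinSeq → ℝ} (hf : IsWindowFunction m f) (k : ℕ) :
    ∃ K : ℝ, ∀ (x : BinSeq) (r : ℤ) (c : Fin 2), HasBlock L p (k + 1) c x r →
      |∑ i ∈ Finset.range (blockLength L (k + 1)), f (shift (r + i) x) - K| ≤ L k * (2 * m) := by
  -- A point with a block of type `a` at the place `0`, as a reference.
  let z : Fin 2 → BinSeq := fun a n => block L p k n.toNat + a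
  have hz : ∀ a, HasBlock L p k a (z a) 0 := fun a i _ => by simp [z]
  let g : Fin 2 → ℝ := fun a => ∑ i ∈ Finset.range (blockLength L k), f (shift (0 + i) (z a))
  refine ⟨L k * (g 0 + g 1) / 2, fun x r c hx => ?_⟩
  have hbal : ∑ j ∈ Finset.range (L k), g (p k j + c) = L k * (g 0 + g 1) / 2 := by
    have h := (hp k).two_mul_sum fun a => g (a + c)
    have hc : g (0 + c) + g (1 + c) = g 0 + g 1 := by
      fin_cases c
      · rfl
      · exact add_comm _ _
    simp only [hc] at h
    linarith
  have hsplit : ∑ i ∈ Finset.range (blockLength L (k + 1)), f (shift (r + i) x) =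
      ∑ j ∈ Finset.range (L k), ∑ i ∈ Finset.range (blockLength L k),
        f (shift (r + j * blockLength L k + i) x) := by
    rw [blockLength, mul_comm, sum_range_mul_eq (fun i => f (shift (r + i) x))]
    simp only [Nat.cast_add, Nat.cast_mul, add_assoc]
  rw [hsplit, ← hbal, ← Finset.sum_sub_distrib]
  calc _ ≤ ∑ j ∈ Finset.range (L k), |∑ i ∈ Finset.range (blockLength L k),
        f (shift (r + j * blockLength L k + i) x) - g (p k j + c)| :=
        Finset.abs_sum_le_sum_abs _ _
    _ ≤ ∑ j ∈ Finset.range (L k), (2 * m : ℝ) :=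
        Finset.sum_le_sum fun j hj =>
          hf.abs_sum_block_sub_le (hx.sub_block (Finset.mem_range.1 hj)) (hz _)
    _ = L k * (2 * m) := by simp

/-- The Birkhoff sums of `f` are uniformly close to multiples of one number `K`. -/
theorem IsWindowFunction.exists_abs_birkhoff_sub_le {hL : ∀ k, 0 < L k}
    (hp : ∀ k, IsBalancedWord (L k) (p k))
    {m : ℕ} {f : BinSeq → ℝ} (hf : IsWindowFunction m f) (k : ℕ) :
    ∃ K : ℝ, ∀ x ∈ (morseSubshift L p hL).carrier, ∀ M : ℕ,
      |∑ i ∈ Finset.range (M * blockLength L (k + 1)), f (shift i x) - M * K| ≤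
        M * (L k * (2 * m)) + blockLength L (k + 1) := by
  obtain ⟨K, hK⟩ := hf.exists_abs_sum_succ_block_sub_le hp k
  refine ⟨K, fun x hx M => ?_⟩
  obtain ⟨r, hr0, hr1, hr⟩ := exists_isAligned hx (k + 1) 0
  obtain ⟨r, rfl⟩ := Int.eq_ofNat_of_zero_le hr0
  have hrle : (r : ℝ) ≤ blockLength L (k + 1) := by
    have : r ≤ blockLength L (k + 1) := by omega
    exact_mod_cast this
  have h1 := abs_sum_sub_sum_add_le (u := fun i => f (shift i x)) (fun _ => hf.nonneg _)
    (fun _ => hf.le_one _) (M * blockLength L (k + 1)) r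
  have h2 : |∑ i ∈ Finset.range (M * blockLength L (k + 1)), f (shift (r + i) x) - M * K| ≤
      M * (L k * (2 * m)) := by
    have e1 : (M * K : ℝ) = ∑ j ∈ Finset.range M, K := by simp
    have e2 : (M * (L k * (2 * m)) : ℝ) = ∑ j ∈ Finset.range M, (L k * (2 * m) : ℝ) := by simp
    rw [sum_range_mul_eq (fun i => f (shift (r + i) x)), e1, e2, ← Finset.sum_sub_distrib]
    refine (Finset.abs_sum_le_sum_abs _ _).trans (Finset.sum_le_sum fun j _ => ?_)
    obtain ⟨c, hc⟩ := hr j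
    have h3 := hK x _ c hc
    simpa only [Nat.cast_add, Nat.cast_mul, add_assoc] using h3
  rw [abs_le] at h1 h2 ⊢
  constructor <;> linarith [h1.1, h1.2, h2.1, h2.2]

/-- Each word of the length of the blocks of rank `k` occurs in all windows that are twice as long
as the blocks of rank `k + 1`, at least once for each pair of neighbouring blocks in a certain
position. -/
theorem le_birkhoff_indicator_cylinder {hL : ∀ k, 0 < L k} (hp : ∀ k, IsBalancedWord (L k) (p k))
    {k : ℕ} {w : Fin (blockLength L k) → Fin 2}
    (hw : w ∈ (morseSubshift L p hL).words (blockLength L k)) {x : BinSeq}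
    (hx : x ∈ (morseSubshift L p hL).carrier) :
    (L k : ℝ) ≤ 8 * ∑ i ∈ Finset.range (2 * blockLength L (k + 1)),
      ((morseSubshift L p hL).cylinder w).indicator 1 (shift (i : ℤ) x) := by
  classical
  obtain ⟨y, hy, hyw⟩ := hw
  obtain ⟨a, b, t, ht, hwin⟩ := exists_window hy k 0
  obtain ⟨r, hr0, hr1, hr⟩ := exists_isAligned hx (k + 1) 0
  obtain ⟨r, rfl⟩ := Int.eq_ofNat_of_zero_le hr0
  obtain ⟨c, hc⟩ := hr.exists_hasBlock
  have hcard := (hp k).le_card_pairs (a - c) (b - c)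
  have hsum : ∑ i ∈ Finset.range (2 * blockLength L (k + 1)),
      ((morseSubshift L p hL).cylinder w).indicator (1 : BinSeq → ℝ) (shift (i : ℤ) x) =
      ((Finset.range (2 * blockLength L (k + 1))).filter fun i : ℕ =>
        shift (i : ℤ) x ∈ (morseSubshift L p hL).cylinder w).card := by
    rw [← Finset.sum_boole]
    rfl
  rw [hsum]
  have hle : ((Finset.range (L k - 1)).filter
      fun j => p k j = a - c ∧ p k (j + 1) = b - c).card ≤
      ((Finset.range (2 * blockLength L (k + 1))).filter fun i : ℕ =>
        shift (i : ℤ) x ∈ (morseSubshift L p hL).cylinder w).card := by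
    refine Finset.card_le_card_of_injOn (fun j => r + j * blockLength L k + t) ?_ ?_
    · intro j hj
      simp only [Finset.coe_filter, Finset.mem_range, Set.mem_ofPred_eq] at hj ⊢
      obtain ⟨hj, hja, hjb⟩ := hj
      obtain ⟨h1, h2⟩ := hc.sub_block_pair (by omega) hja hjb
      refine ⟨?_, shift_mem_morseSubshift hx _, fun i => ?_⟩
      · have h3 : (j + 1) * blockLength L k ≤ blockLength L (k + 1) := by
          rw [blockLength, mul_comm]
          exact Nat.mul_le_mul_left _ (by omega)
        rw [Nat.succ_mul] at h3
        omega
      · rw [← hyw i, shift_apply]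
        have h3 := hwin x _ h1 h2 i i.2
        rw [zero_add] at h3
        rw [← h3]
        push_cast
        rfl
    · intro i _ j _ hij
      have : i * blockLength L k = j * blockLength L k := by
        simp only at hij
        omega
      exact Nat.eq_of_mul_eq_mul_right (blockLength_pos hL k) this
  exact_mod_cast hcard.trans (Nat.mul_le_mul_left 8 hle)

/-! ### Invariant measures -/

/-- The **Krylov–Bogoliubov theorem**: a continuous map of a compact metrizable space has an
invariant probability measure on each nonempty closed set that is mapped into itself. It is a limit
of the uniform distributions on initial pieces of an orbit. -/
theorem exists_measurePreserving_of_compactSpace {X : Type*} [TopologicalSpace X] [CompactSpace X]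
    [TopologicalSpace.MetrizableSpace X] [MeasurableSpace X] [BorelSpace X] {T : X → X}
    (hT : Continuous T) {K : Set X} (hK : IsClosed K) (hTK : Set.MapsTo T K K)
    (hne : K.Nonempty) :
    ∃ μ : Measure X, IsProbabilityMeasure μ ∧ μ Kᶜ = 0 ∧ MeasurePreserving T μ μ := by
  obtain ⟨x, hx⟩ := hne
  let ν : ℕ → Measure X := fun n =>
    ((n + 1 : ℕ) : ℝ≥0∞)⁻¹ • ∑ i ∈ Finset.range (n + 1), Measure.dirac (T^[i] x)
  have hν : ∀ n S, (∀ i, Measure.dirac (T^[i] x) S = 1) → ν n S = 1 := by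
    intro n S hS
    simp only [ν, Measure.smul_apply, Measure.finsetSum_apply, hS, Finset.sum_const,
      Finset.card_range, smul_eq_mul, nsmul_eq_mul, mul_one]
    exact ENNReal.inv_mul_cancel (by simp) (ENNReal.natCast_ne_top _)
  have hνprob : ∀ n, IsProbabilityMeasure (ν n) := fun n =>
    ⟨hν n _ fun i => measure_univ⟩
  have hνK : ∀ n, ν n K = 1 := fun n => hν n K fun i => by
    rw [Measure.dirac_apply' _ hK.measurableSet, Set.indicator_of_mem (hTK.iterate i hx),
      Pi.one_apply]
  have hνint : ∀ n (f : BoundedContinuousFunction X ℝ),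
      ∫ y, f y ∂(ν n) = ((n + 1 : ℕ) : ℝ)⁻¹ * ∑ i ∈ Finset.range (n + 1), f (T^[i] x) := by
    intro n f
    rw [integral_smul_measure, integral_finsetSum_measure fun i _ => f.integrable _,
      ENNReal.toReal_inv, ENNReal.toReal_natCast]
    simp [integral_dirac]
  let P : ℕ → ProbabilityMeasure X := fun n => ⟨ν n, hνprob n⟩
  let μ : ProbabilityMeasure X := ((hyperfilter ℕ).map P).lim
  have hlim : Tendsto P (hyperfilter ℕ) (𝓝 μ) := ((hyperfilter ℕ).map P).le_nhds_lim
  refine ⟨μ, inferInstance, ?_, hT.measurable, ?_⟩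
  · rw [prob_compl_eq_zero_iff hK.measurableSet]
    refine le_antisymm prob_le_one ?_
    have h := ProbabilityMeasure.limsup_measure_closed_le_of_tendsto hlim hK
    have h2 : (fun n => (P n : Measure X) K) = fun _ => 1 := funext hνK
    rwa [h2, limsup_const] at h
  · have : IsProbabilityMeasure (Measure.map T (μ : Measure X)) :=
      Measure.isProbabilityMeasure_map hT.aemeasurable
    refine ext_of_forall_integral_eq_of_IsFiniteMeasure fun f => ?_
    rw [integral_map hT.aemeasurable f.continuous.aestronglyMeasurable]
    have h1 := ProbabilityMeasure.tendsto_iff_forall_integral_tendsto.1 hlim f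
    have h2 := ProbabilityMeasure.tendsto_iff_forall_integral_tendsto.1 hlim
      (f.compContinuous ⟨T, hT⟩)
    -- The averages of `f` and `f ∘ T` over the first `n + 1` points differ by a telescoping sum.
    have h3 : Tendsto (fun n => ∫ y, f.compContinuous ⟨T, hT⟩ y ∂(P n : Measure X) -
        ∫ y, f y ∂(P n : Measure X)) (hyperfilter ℕ) (𝓝 0) := by
      refine Tendsto.mono_left ?_ Nat.hyperfilter_le_atTop
      have h4 : ∀ n, ∫ y, f.compContinuous ⟨T, hT⟩ y ∂(P n : Measure X) -
          ∫ y, f y ∂(P n : Measure X) = ((n + 1 : ℕ) : ℝ)⁻¹ * (f (T^[n + 1] x) - f x) := by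
        intro n
        refine (congrArg₂ (· - ·) (hνint n _) (hνint n f)).trans ?_
        have h5 := Finset.sum_range_sub (fun i => f (T^[i] x)) (n + 1)
        rw [Function.iterate_zero_apply] at h5
        rw [← mul_sub, ← h5, Finset.sum_sub_distrib]
        simp only [Function.iterate_succ_apply', BoundedContinuousFunction.compContinuous_apply,
          ContinuousMap.coe_mk]
      simp only [h4]
      have h6 : Tendsto (fun n : ℕ => ((n + 1 : ℕ) : ℝ)⁻¹) atTop (𝓝 0) :=
        (tendsto_inv_atTop_nhds_zero_nat (𝕜 := ℝ)).comp (tendsto_add_atTop_nat 1)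
      refine h6.zero_mul_isBoundedUnder_le ?_
      refine isBoundedUnder_of ⟨2 * ‖f‖, fun n => ?_⟩
      have := f.norm_coe_le_norm (T^[n + 1] x)
      have := f.norm_coe_le_norm x
      exact (norm_sub_le _ _).trans (by linarith)
    have h7 := tendsto_nhds_unique (h2.sub h1) h3
    exact sub_eq_zero.1 h7

theorem leftShift_iterate (n : ℕ) (x : BinSeq) : BinSubshift.leftShift^[n] x = shift (n : ℤ) x := by
  induction n with
  | zero => simp
  | succ n ih =>
    rw [Function.iterate_succ_apply', ih]
    funext i
    simp only [BinSubshift.leftShift, shift_apply]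
    congr 1
    push_cast
    ring

theorem exists_isInvariantProbability (Y : BinSubshift) (hY : Y.carrier.Nonempty) :
    ∃ μ, Y.IsInvariantProbability μ := by
  obtain ⟨μ, h1, h2, h3⟩ := exists_measurePreserving_of_compactSpace
    (T := BinSubshift.leftShift) (SymbolicDynamics.FullShift.continuous_shift 1) Y.isClosed
    (Y.mapsTo 1) hY
  exact ⟨μ, h1, h2, h3⟩

namespace BinSubshift.IsInvariantProbability

variable {Y : BinSubshift} {μ : Measure BinSeq}

theorem ae_mem (hμ : Y.IsInvariantProbability μ) : ∀ᵐ x ∂μ, x ∈ Y.carrier :=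
  hμ.measure_compl_eq_zero

theorem measurePreserving_shift (hμ : Y.IsInvariantProbability μ) (n : ℕ) :
    MeasurePreserving (shift (n : ℤ) : BinSeq → BinSeq) μ μ := by
  rw [← funext (leftShift_iterate n)]
  exact hμ.measurePreserving.iterate n

theorem integrable_sum_shift (hμ : Y.IsInvariantProbability μ) {f : BinSeq → ℝ}
    (hf : Integrable f μ) (n : ℕ) :
    Integrable (fun x => ∑ i ∈ Finset.range n, f (shift (i : ℤ) x)) μ :=
  integrable_finsetSum _ fun i _ => (hμ.measurePreserving_shift i).integrable_comp_of_integrable hf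

theorem integral_sum_shift (hμ : Y.IsInvariantProbability μ) {f : BinSeq → ℝ}
    (hf : Integrable f μ) (n : ℕ) :
    ∫ x, ∑ i ∈ Finset.range n, f (shift (i : ℤ) x) ∂μ = n * ∫ x, f x ∂μ := by
  have hint : ∀ i ∈ Finset.range n, Integrable (fun x => f (shift (i : ℤ) x)) μ := fun i _ =>
    (hμ.measurePreserving_shift i).integrable_comp_of_integrable hf
  rw [integral_finsetSum _ hint]
  have h : ∀ i : ℕ, ∫ x, f (shift (i : ℤ) x) ∂μ = ∫ x, f x ∂μ := by
    intro i
    have hi := hμ.measurePreserving_shift i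
    rw [← integral_map (φ := shift (i : ℤ)) (f := f) hi.measurable.aemeasurable
      (by rw [hi.map_eq]; exact hf.1), hi.map_eq]
  simp [h]

/-- A lower bound for Birkhoff sums on the subshift bounds integrals from below. -/
theorem le_mul_integral (hμ : Y.IsInvariantProbability μ) {f : BinSeq → ℝ}
    (hf : Integrable f μ) {n : ℕ} {c : ℝ}
    (h : ∀ x ∈ Y.carrier, c ≤ ∑ i ∈ Finset.range n, f (shift (i : ℤ) x)) :
    c ≤ n * ∫ x, f x ∂μ := by
  have := hμ.isProbabilityMeasure
  rw [← hμ.integral_sum_shift hf]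
  calc c = ∫ _, c ∂μ := by simp
    _ ≤ _ := integral_mono_ae (integrable_const c) (hμ.integrable_sum_shift hf n)
      (hμ.ae_mem.mono h)

theorem mul_integral_le (hμ : Y.IsInvariantProbability μ) {f : BinSeq → ℝ}
    (hf : Integrable f μ) {n : ℕ} {c : ℝ}
    (h : ∀ x ∈ Y.carrier, ∑ i ∈ Finset.range n, f (shift (i : ℤ) x) ≤ c) :
    n * ∫ x, f x ∂μ ≤ c := by
  have h1 := hμ.le_mul_integral hf.neg (c := -c) (n := n) fun x hx => by
    simpa using h x hx
  simp only [Pi.neg_apply, integral_neg] at h1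
  linarith

end BinSubshift.IsInvariantProbability

theorem IsWindowFunction.integrable {m : ℕ} {f : BinSeq → ℝ} (hf : IsWindowFunction m f)
    (hmeas : Measurable f) (μ : Measure BinSeq) [IsFiniteMeasure μ] : Integrable f μ :=
  Integrable.of_bound hmeas.aestronglyMeasurable 1
    (Eventually.of_forall fun x => by
      rw [Real.norm_of_nonneg (hf.nonneg x)]
      exact hf.le_one x)

theorem IsWindowFunction.integral_eq {hL : ∀ k, 0 < L k} (hp : ∀ k, IsBalancedWord (L k) (p k))
    {m : ℕ} {f : BinSeq → ℝ} (hf : IsWindowFunction m f) (hmeas : Measurable f)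
    {μ ν : Measure BinSeq} (hμ : (morseSubshift L p hL).IsInvariantProbability μ)
    (hν : (morseSubshift L p hL).IsInvariantProbability ν) :
    ∫ x, f x ∂μ = ∫ x, f x ∂ν := by
  have := hμ.isProbabilityMeasure
  have := hν.isProbabilityMeasure
  have key : ∀ k : ℕ, |∫ x, f x ∂μ - ∫ x, f x ∂ν| * blockLength L k ≤ 4 * m + 2 := by
    intro k
    obtain ⟨K, hK⟩ := hf.exists_abs_birkhoff_sub_le (hL := hL) hp k
    -- With `blockLength L k` blocks of rank `k + 1`, both error terms have the same size.
    set ℓ := blockLength L k with hℓ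
    have hbound : ∀ ρ : Measure BinSeq, (morseSubshift L p hL).IsInvariantProbability ρ →
        |(ℓ * blockLength L (k + 1) : ℕ) * ∫ x, f x ∂ρ - ℓ * K| ≤
          ℓ * (L k * (2 * m)) + blockLength L (k + 1) := by
      intro ρ hρ
      have := hρ.isProbabilityMeasure
      have hi := hf.integrable hmeas ρ
      have h1 := hρ.le_mul_integral hi (n := ℓ * blockLength L (k + 1))
        (c := ℓ * K - (ℓ * (L k * (2 * m)) + blockLength L (k + 1)))
        fun x hx => by linarith [neg_le_of_abs_le (hK x hx ℓ)]
      have h2 := hρ.mul_integral_le hi (n := ℓ * blockLength L (k + 1))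
        (c := ℓ * K + (ℓ * (L k * (2 * m)) + blockLength L (k + 1)))
        fun x hx => by linarith [le_of_abs_le (hK x hx ℓ)]
      rw [abs_le]
      constructor <;> linarith
    have h1 := hbound μ hμ
    have h2 := hbound ν hν
    have hpos : (0 : ℝ) < ℓ * L k := by
      have := blockLength_pos hL k
      have := hL k
      positivity
    have hsucc : (blockLength L (k + 1) : ℝ) = ℓ * L k := by
      rw [blockLength]
      push_cast
      rfl
    rw [Nat.cast_mul, hsucc] at h1 h2
    have h3 : |∫ x, f x ∂μ - ∫ x, f x ∂ν| * ℓ * (ℓ * L k) ≤ (4 * m + 2) * (ℓ * L k) := by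
      have e : |∫ x, f x ∂μ - ∫ x, f x ∂ν| * ℓ * (ℓ * L k) =
          |(ℓ * (ℓ * L k)) * ∫ x, f x ∂μ - (ℓ * (ℓ * L k)) * ∫ x, f x ∂ν| := by
        rw [← mul_sub, abs_mul, abs_of_nonneg (by positivity : (0 : ℝ) ≤ ℓ * (ℓ * L k))]
        ring
      rw [e, abs_le]
      rw [abs_le] at h1 h2
      constructor <;> linarith [h1.1, h1.2, h2.1, h2.2]
    exact le_of_mul_le_mul_right h3 hpos
  by_contra hne
  have hd : 0 < |∫ x, f x ∂μ - ∫ x, f x ∂ν| := abs_pos.2 (sub_ne_zero.2 hne)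
  obtain ⟨k, hk⟩ := exists_nat_gt ((4 * m + 2) / |∫ x, f x ∂μ - ∫ x, f x ∂ν|)
  have h1 : (k : ℝ) ≤ blockLength L k := by
    exact_mod_cast Nat.lt_two_pow_self.le.trans
      (two_pow_le_blockLength (fun k => (hp k).two_le) k)
  rw [div_lt_iff₀ hd] at hk
  nlinarith [key k]

theorem isUniquelyErgodic_morseSubshift {hL : ∀ k, 0 < L k}
    (hp : ∀ k, IsBalancedWord (L k) (p k)) : (morseSubshift L p hL).IsUniquelyErgodic := by
  obtain ⟨μ, hμ⟩ := exists_isInvariantProbability _ (morseSubshift_nonempty (p := p) hL)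
  refine ⟨μ, hμ, fun ν hν => ?_⟩
  have := hμ.isProbabilityMeasure
  have := hν.isProbabilityMeasure
  refine ext_of_generate_finite (measurableCylinders _) generateFrom_measurableCylinders.symm
    isPiSystem_measurableCylinders (fun s hs => ?_) (by simp)
  have hsm := MeasurableSet.of_mem_measurableCylinders hs
  obtain ⟨I, S, -, rfl⟩ := (mem_measurableCylinders s).1 hs
  set A : Set BinSeq := MeasureTheory.cylinder I S
  have hwin : IsWindowFunction (I.sup Int.natAbs) (A.indicator 1) := by
    refine ⟨fun x => Set.indicator_nonneg (fun _ _ => zero_le_one) x, fun x =>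
      Set.indicator_le_self' (fun _ _ => zero_le_one) x, fun x y hxy => ?_⟩
    have h : x ∈ A ↔ y ∈ A := by
      have hr : I.restrict x = I.restrict y :=
        funext fun i => hxy i (Finset.le_sup (f := Int.natAbs) i.2)
      rw [MeasureTheory.mem_cylinder, MeasureTheory.mem_cylinder, hr]
    by_cases hx : x ∈ A
    · rw [Set.indicator_of_mem hx, Set.indicator_of_mem (h.1 hx)]
      rfl
    · rw [Set.indicator_of_notMem hx, Set.indicator_of_notMem fun hy => hx (h.2 hy)]
  have h := hwin.integral_eq hp (measurable_one.indicator hsm) hν hμ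
  rw [integral_indicator_one hsm, integral_indicator_one hsm] at h
  exact (measureReal_eq_measureReal_iff).1 h

theorem measurableSet_cylinder (Y : BinSubshift) {n : ℕ} (w : Fin n → Fin 2) :
    MeasurableSet (Y.cylinder w) := by
  have h : Y.cylinder w = Y.carrier ∩ ⋂ j : Fin n, {x | x ((j : ℕ) : ℤ) = w j} := by
    ext x
    simp [BinSubshift.cylinder]
  rw [h]
  refine Y.isClosed.measurableSet.inter ?_
  exact MeasurableSet.iInter fun j =>
    (isClosed_eq (continuous_apply _) continuous_const).measurableSet

/-- The words of the length of the blocks of rank `k` have measure at least `1 / 16` of the inverse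
of their length. -/
theorem one_div_le_measure_cylinder_mul {hL : ∀ k, 0 < L k} (hp : ∀ k, IsBalancedWord (L k) (p k))
    {μ : Measure BinSeq} (hμ : (morseSubshift L p hL).IsInvariantProbability μ)
    {k : ℕ} {w : Fin (blockLength L k) → Fin 2}
    (hw : w ∈ (morseSubshift L p hL).words (blockLength L k)) :
    (16 : ℝ≥0∞)⁻¹ ≤ μ ((morseSubshift L p hL).cylinder w) * blockLength L k := by
  have := hμ.isProbabilityMeasure
  have hm := measurableSet_cylinder (morseSubshift L p hL) w
  have h := hμ.le_mul_integral
    (f := ((morseSubshift L p hL).cylinder w).indicator (1 : BinSeq → ℝ))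
    (n := 2 * blockLength L (k + 1)) (c := L k / 8)
    ((integrable_const (1 : ℝ)).indicator hm) fun x hx => by
      linarith [le_birkhoff_indicator_cylinder hp hw hx]
  rw [integral_indicator_one hm, blockLength] at h
  have hLk : (0 : ℝ) < L k := by exact_mod_cast hL k
  have h1 : (16 : ℝ)⁻¹ ≤ μ.real ((morseSubshift L p hL).cylinder w) * blockLength L k := by
    push_cast at h
    refine le_of_mul_le_mul_right ?_ hLk
    linarith
  have h2 := ENNReal.ofReal_le_ofReal h1
  rwa [ENNReal.ofReal_mul measureReal_nonneg, ofReal_measureReal, ENNReal.ofReal_natCast,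
    ENNReal.ofReal_inv_of_pos (by norm_num), ENNReal.ofReal_ofNat] at h2

theorem conditionB_morseSubshift {hL : ∀ k, 0 < L k} (hp : ∀ k, IsBalancedWord (L k) (p k))
    {μ : Measure BinSeq} (hμ : (morseSubshift L p hL).IsInvariantProbability μ) :
    (morseSubshift L p hL).ConditionB μ := by
  refine ⟨blockLength L, ?_, ?_⟩
  · exact tendsto_atTop_mono (fun k => Nat.lt_two_pow_self.le.trans
      (two_pow_le_blockLength (fun k => (hp k).two_le) k)) tendsto_id
  · have h : (16 : ℝ≥0∞)⁻¹ ≤ liminf (fun k : ℕ => ⨅ w ∈ (morseSubshift L p hL).words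
        (blockLength L k), μ ((morseSubshift L p hL).cylinder w) * (blockLength L k : ℝ≥0∞))
        atTop :=
      le_liminf_of_le (by isBoundedDefault) (Eventually.of_forall fun k =>
        le_iInf₂ fun w hw => one_div_le_measure_cylinder_mul hp hμ hw)
    exact lt_of_lt_of_le (by simp) h

/-! ### Choice of the word lengths -/

/-- If `a` grows subexponentially, then `2 ^ N` exceeds each multiple of `a (N * l)` for some
`N`. -/
theorem exists_mul_lt_two_pow {a : ℕ → ℕ} (ha : ∀ n : ℕ, 1 ≤ n → 0 < a n)
    (hgrowth : limsup (fun n : ℕ => ((1 / (n : ℝ) * Real.log (a n : ℝ) : ℝ) : EReal)) atTop = 0)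
    {l : ℕ} (hl : 0 < l) (c : ℕ) : ∃ N, 2 ≤ N ∧ c * a (N * l) < 2 ^ N := by
  have hlog2 : 0 < Real.log 2 := Real.log_pos one_lt_two
  have hl' : (0 : ℝ) < l := by exact_mod_cast hl
  have h1 : ∀ᶠ n : ℕ in atTop, 1 / (n : ℝ) * Real.log (a n : ℝ) < Real.log 2 / (2 * l) := by
    have h : limsup (fun n : ℕ => ((1 / (n : ℝ) * Real.log (a n : ℝ) : ℝ) : EReal)) atTop <
        ((Real.log 2 / (2 * l) : ℝ) : EReal) := by
      rw [hgrowth]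
      exact EReal.coe_pos.2 (by positivity)
    exact (eventually_lt_of_limsup_lt h).mono fun n hn => EReal.coe_lt_coe_iff.1 hn
  have h2 : Tendsto (fun N : ℕ => N * l) atTop atTop := tendsto_id.atTop_mul_const' hl
  have h3 : ∀ᶠ N : ℕ in atTop, Real.log (c + 1 : ℝ) / (Real.log 2 / 2) ≤ N :=
    tendsto_natCast_atTop_atTop.eventually_ge_atTop _
  obtain ⟨N, hN1, hN3, hN2⟩ := ((h2.eventually h1).and (h3.and (eventually_ge_atTop 2))).exists
  refine ⟨N, hN2, ?_⟩
  have hN : (0 : ℝ) < N := by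
    have : 0 < N := by omega
    exact_mod_cast this
  have hapos : (0 : ℝ) < a (N * l) := by
    have : 1 ≤ N * l := Nat.mul_pos (by omega) hl
    exact_mod_cast ha _ this
  rw [div_le_iff₀ (by positivity)] at hN3
  rw [one_div_mul_eq_div, Nat.cast_mul, div_lt_div_iff₀ (by positivity) (by positivity)] at hN1
  have h4 : Real.log (a (N * l)) < N * Real.log 2 / 2 := by
    refine lt_of_mul_lt_mul_right (a := 2 * (l : ℝ)) ?_ (by positivity)
    linarith
  have h5 : Real.log ((c + 1) * a (N * l)) < Real.log (2 ^ N) := by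
    rw [Real.log_mul (by positivity) hapos.ne', Real.log_pow]
    linarith
  have h6 : ((c + 1) * a (N * l) : ℝ) < 2 ^ N :=
    (Real.log_lt_log_iff (by positivity) (by positivity)).1 h5
  have h7 : (c * a (N * l) : ℝ) < 2 ^ N := by linarith
  exact_mod_cast h7

/-- The word lengths can be chosen one after the other, each in dependence on the length of the
blocks that are built from the previous words. -/
theorem exists_wordLength {a : ℕ → ℕ} (ha : ∀ n : ℕ, 1 ≤ n → 0 < a n)
    (hgrowth : limsup (fun n : ℕ => ((1 / (n : ℝ) * Real.log (a n : ℝ) : ℝ) : EReal)) atTop = 0) :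
    ∃ N : ℕ → ℕ, ∀ k, 2 ≤ N k ∧
      k * a (N k * blockLength (fun k => 2 ^ N k * N k) k) < 2 ^ N k := by
  have h : ∀ l c : ℕ, ∃ N, 2 ≤ N ∧ (0 < l → c * a (N * l) < 2 ^ N) := by
    intro l c
    rcases Nat.eq_zero_or_pos l with rfl | hl
    · exact ⟨2, le_rfl, fun h => absurd h (lt_irrefl 0)⟩
    · obtain ⟨N, h1, h2⟩ := exists_mul_lt_two_pow ha hgrowth hl c
      exact ⟨N, h1, fun _ => h2⟩
  choose F hF2 hF using h
  let len : ℕ → ℕ := fun k => Nat.rec 1 (fun j l => l * (2 ^ F l j * F l j)) k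
  have hlen : ∀ k, blockLength (fun k => 2 ^ F (len k) k * F (len k) k) k = len k := by
    intro k
    induction k with
    | zero => rfl
    | succ k ih => rw [blockLength, ih]
  refine ⟨fun k => F (len k) k, fun k => ⟨hF2 _ _, ?_⟩⟩
  have hpos := blockLength_pos (L := fun k => 2 ^ F (len k) k * F (len k) k)
    (fun k => Nat.mul_pos (by positivity) (by linarith [hF2 (len k) k])) k
  rw [hlen] at hpos ⊢
  exact hF _ _ hpos

theorem theorem1p1 (a : ℕ → ℕ) (ha : ∀ n : ℕ, 1 ≤ n → 0 < a n)
    (hgrowth : limsup (fun n : ℕ => ((1 / (n : ℝ) * Real.log (a n : ℝ) : ℝ) : EReal)) atTop = 0) :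
    ∃ Y : BinSubshift,
      BinSubshift.IsMinimal Y ∧
      BinSubshift.IsUniquelyErgodic Y ∧
      limsup (fun n : ℕ => (BinSubshift.complexity Y n : ℝ≥0∞) / (a n : ℝ≥0∞)) atTop = ⊤ ∧
      ∀ μ : Measure BinSeq, BinSubshift.IsInvariantProbability Y μ →
        BinSubshift.ConditionB Y μ := by
  obtain ⟨N, hN⟩ := exists_wordLength ha hgrowth
  let L : ℕ → ℕ := fun k => 2 ^ N k * N k
  have hp : ∀ k, IsBalancedWord (L k) (digitWord (N k)) := fun k =>
    isBalancedWord_digitWord (hN k).1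
  have hL : ∀ k, 0 < L k := fun k => (hp k).pos
  refine ⟨morseSubshift L (fun k => digitWord (N k)) hL, isMinimal_morseSubshift hp,
    isUniquelyErgodic_morseSubshift hp, ?_, fun μ hμ => conditionB_morseSubshift hp hμ⟩
  have hle : ∀ k, k ≤ N k * blockLength L k := fun k =>
    calc k ≤ 2 ^ k := Nat.lt_two_pow_self.le
      _ ≤ blockLength L k := two_pow_le_blockLength (fun k => (hp k).two_le) k
      _ ≤ N k * blockLength L k := Nat.le_mul_of_pos_left _ (by linarith [(hN k).1])
  refine ENNReal.eq_top_of_forall_nnreal_le fun r => ?_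
  refine le_limsup_of_frequently_le ?_ (by isBoundedDefault)
  rw [frequently_atTop]
  intro n
  obtain ⟨c, hc⟩ := exists_nat_ge r
  -- The rank `k = n + c + 1` is positive, and gives a length above `n` and a quotient above `r`.
  let k := n + c + 1
  refine ⟨N k * blockLength L k, by linarith [hle k, show n ≤ k by omega], ?_⟩
  have h1 : 0 < a (N k * blockLength L k) := ha _ (by linarith [hle k, show 1 ≤ k by omega])
  have h2 : k * a (N k * blockLength L k) ≤
      (morseSubshift L (fun k => digitWord (N k)) hL).complexity (N k * blockLength L k) :=
    (hN k).2.le.trans (two_pow_le_complexity fun w => exists_digitWord_eq w)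
  rw [ENNReal.le_div_iff_mul_le (Or.inl (by exact_mod_cast h1.ne'))
    (Or.inl (ENNReal.natCast_ne_top _))]
  calc (r : ℝ≥0∞) * a (N k * blockLength L k) ≤ (k : ℝ≥0∞) * a (N k * blockLength L k) := by
        gcongr
        have h3 : (c : NNReal) ≤ (k : ℕ) := by exact_mod_cast (show c ≤ k by omega)
        exact_mod_cast hc.trans h3
    _ ≤ _ := by exact_mod_cast h2
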